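/- Let $C$ be a commutative C*-algebra, not necessarily unital. A Hilbert $C$-module is a complex vector space and (right) $C$-module $E$ with a $C$-valued inner product $\langle -,-\rangle_E$ that is $C$-linear in the second variable and satisfies $\langle x,y\rangle^*=\langle y,x\rangle$, $\langle x,x\rangle\ge 0$, and $\langle x,x\rangle=0$ if and only if $x=0$, such that $E$ is complete in the norm $\|x\|=\|\langle x,x\rangle\|^{1/2}$. For Hilbert $C$-modules $E,F$, let $E\otimes F$ be the Hilbert $C$-module obtained from the algebraic tensor product $E\otimes_{\mathbb C}F$ by (quotienting out null vectors and) completing with respect to $$\langle x_1\otimes y_1,x_2\otimes y_2\rangle=\langle x_1,x_2\rangle\langle y_1,y_2\rangle,\qquad (x\otimes y)c=x\otimes(yc).$$ Let $\mathbf{Hilb}_C^{\mathrm{bd}}$ be the category of Hilbert $C$-modules and bounded $C$-linear maps. Let $\mathbf{Hilb}_C$ be the dagger category of Hilbert $C$-modules and adjointable maps, i.e. functions $f\colon E\to F$ for which there is a function $f^\dagger\colon F\to E$ with $\langle f(x),y\rangle=\langle x,f^\dagger(y)\rangle$ for all $x\in E$, $y\in F$; its dagger is $f\mapsto f^\dagger$.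 Then each of the categories $\mathbf{Hilb}_C^{\mathrm{bd}}$ and $\mathbf{Hilb}_C$ is symmetric monoidal, with tensor product of objects $E\otimes F$ and unit object $C$ (with $\langle a,b\rangle=a^*b$), where the tensor product of morphisms, the associators, the left and right unitors and the symmetries are given on elementary tensors by $$(f\otimes g)(x\otimes y)=f(x)\otimes g(y),\quad (x\otimes y)\otimes z\mapsto x\otimes(y\otimes z),\quad c\otimes x\mapsto xc,\quad x\otimes c\mapsto xc,\quad x\otimes y\mapsto y\otimes x.$$ Moreover, $\mathbf{Hilb}_C$ is a symmetric monoidal dagger category: $(f\otimes g)^\dagger=f^\dagger\otimes g^\dagger$ for all adjointable $f,g$, and the associators, unitors and symmetries are unitary, i.e. their inverses are their daggers. -/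

import Mathlib

open CategoryTheory MonoidalCategory
open scoped TensorProduct ComplexOrder

universe u

set_option linter.unusedSectionVars false

/-! ### The algebraic tensor product and its `C`-valued inner product -/

/-- The algebraic tensor product over `ℂ` of two modules over `C`. This is a type synonym of
`E ⊗[ℂ] F` that carries the seminorm induced by the `C`-valued inner product. -/
def AlgTensor (_C E F : Type u) [AddCommGroup E] [Module ℂ E] [AddCommGroup F] [Module ℂ F] :
    Type u := E ⊗[ℂ] F

namespace AlgTensor

section Algebra

variable (C E F : Type u) [AddCommGroup E] [Module ℂ E] [AddCommGroup F] [Module ℂ F]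

instance : AddCommGroup (AlgTensor C E F) := inferInstanceAs (AddCommGroup (E ⊗[ℂ] F))

instance : Module ℂ (AlgTensor C E F) := inferInstanceAs (Module ℂ (E ⊗[ℂ] F))

variable {E F}

/-- The elementary tensor `x ⊗ y` in the algebraic tensor product. -/
def tmul (x : E) (y : F) : AlgTensor C E F := x ⊗ₜ[ℂ] y

variable {C}

theorem induction_on {P : AlgTensor C E F → Prop} (t : AlgTensor C E F) (h0 : P 0)
    (h1 : ∀ x y, P (tmul C x y)) (h2 : ∀ s t, P s → P t → P (s + t)) : P t :=
  TensorProduct.induction_on (motive := P) t h0 h1 h2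

end Algebra

variable {C E F : Type u} [NonUnitalCommCStarAlgebra C] [PartialOrder C] [StarOrderedRing C]
  [NormedAddCommGroup E] [NormedSpace ℂ E] [SMul C E] [CStarModule C E]
  [NormedAddCommGroup F] [NormedSpace ℂ F] [SMul C F] [CStarModule C F]

variable (C E) in
theorem op_smul_add (c : C) (x y : E) : c • (x + y) = c • x + c • y := by
  rw [← sub_eq_zero, ← CStarModule.inner_self (A := C)]
  simp [mul_add]

variable (C E) in
theorem op_smul_smul (c : C) (z : ℂ) (x : E) : c • (z • x) = z • (c • x) := by
  have h (d : E) : inner C d (c • (z • x) - z • (c • x)) = 0 := by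
    simp only [CStarModule.inner_sub_right, CStarModule.inner_op_smul_right,
      CStarModule.inner_smul_right_complex, mul_smul_comm, sub_self]
  rw [← sub_eq_zero, ← CStarModule.inner_self (A := C), h]

variable (E) in
/-- The action of an element of `C` on a Hilbert module, as a `ℂ`-linear map. -/
def opSmul (c : C) : E →ₗ[ℂ] E where
  toFun x := c • x
  map_add' := op_smul_add C E c
  map_smul' z x := op_smul_smul C E c z x

/-- The action of `C` on the tensor product: `c • (x ⊗ y) = x ⊗ (c • y)`. -/
instance : SMul C (AlgTensor C E F) where
  smul c t := LinearMap.lTensor E (opSmul F c) t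

theorem smul_tmul (c : C) (x : E) (y : F) : c • tmul C x y = tmul C x (c • y) := rfl

theorem smul_add' (c : C) (s t : AlgTensor C E F) : c • (s + t) = c • s + c • t :=
  map_add (LinearMap.lTensor E (opSmul F c)) s t

theorem smul_zero' (c : C) : c • (0 : AlgTensor C E F) = 0 :=
  map_zero (LinearMap.lTensor E (opSmul F c))

/-- The `C`-valued form on the tensor product, determined by
`⟨x₁ ⊗ y₁, x₂ ⊗ y₂⟩ = ⟨x₁, x₂⟩ * ⟨y₁, y₂⟩`. -/
noncomputable def form : AlgTensor C E F →ₗ⋆[ℂ] AlgTensor C E F →ₗ[ℂ] C :=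
  (TensorProduct.lift <| TensorProduct.mapBilinear (.id ℂ) E F C C).compr₂ (.mul' ℂ C) ∘ₛₗ
    TensorProduct.map (CStarModule.innerₛₗ (A := C) (E := E))
      (CStarModule.innerₛₗ (A := C) (E := F))

noncomputable instance : Inner C (AlgTensor C E F) where
  inner s t := form s t

theorem inner_def (s t : AlgTensor C E F) : inner C s t = form s t := rfl

theorem inner_tmul (x₁ x₂ : E) (y₁ y₂ : F) :
    inner C (tmul C x₁ y₁) (tmul C x₂ y₂) = inner C x₁ x₂ * inner C y₁ y₂ := rfl

theorem form_tmul (x₁ x₂ : E) (y₁ y₂ : F) :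
    form (tmul C x₁ y₁) (tmul C x₂ y₂) = inner C x₁ x₂ * inner C y₁ y₂ := rfl

theorem star_form (s t : AlgTensor C E F) : star (form s t) = form t s := by
  induction s using induction_on with
  | h0 => simp
  | h1 x y =>
    induction t using induction_on with
    | h0 => simp
    | h1 x' y' => simp [form_tmul]
    | h2 a b ha hb => simp [ha, hb]
  | h2 a b ha hb => simp [ha, hb]

theorem form_smul_right (c : C) (s t : AlgTensor C E F) : form s (c • t) = c * form s t := by
  induction s using induction_on with
  | h0 => simp
  | h1 x y =>
    induction t using induction_on with
    | h0 => simp [smul_zero']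
    | h1 x' y' => simp [form_tmul, smul_tmul, mul_left_comm]
    | h2 a b ha hb => simp [smul_add', ha, hb, mul_add]
  | h2 a b ha hb => simp [ha, hb, mul_add]

/-! ### Positivity -/

/-- Evaluation of a character of the unitization at an element of `C`. -/
noncomputable def ev (φ : WeakDual.characterSpace ℂ (Unitization ℂ C)) : C →ₗ[ℂ] ℂ where
  toFun c := φ (c : Unitization ℂ C)
  map_add' a b := by simp
  map_smul' z a := by simp

theorem ev_mul (φ : WeakDual.characterSpace ℂ (Unitization ℂ C)) (a b : C) :
    ev φ (a * b) = ev φ a * ev φ b := by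
  simp [ev]

theorem ev_star (φ : WeakDual.characterSpace ℂ (Unitization ℂ C)) (a : C) :
    ev φ (star a) = star (ev φ a) := by
  simp only [ev, LinearMap.coe_mk, AddHom.coe_mk, Unitization.inr_star]
  exact map_star φ _

theorem ev_nonneg (φ : WeakDual.characterSpace ℂ (Unitization ℂ C)) {a : C} (ha : 0 ≤ a) :
    0 ≤ ev φ a := by
  obtain ⟨b, rfl⟩ := CStarAlgebra.nonneg_iff_eq_star_mul_self.mp ha
  rw [ev_mul, ev_star]
  exact star_mul_self_nonneg _

theorem norm_ev_le (φ : WeakDual.characterSpace ℂ (Unitization ℂ C)) (a : C) :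
    ‖ev φ a‖ ≤ ‖a‖ := by
  have h := spectrum.norm_le_norm_of_mem (WeakDual.CharacterSpace.apply_mem_spectrum φ
    (a : Unitization ℂ C))
  rwa [Unitization.norm_inr] at h

theorem nonneg_of_ev {a : C} (ha : IsSelfAdjoint a)
    (h : ∀ φ : WeakDual.characterSpace ℂ (Unitization ℂ C), 0 ≤ ev φ a) : 0 ≤ a := by
  rw [nonneg_iff_isSelfAdjoint_and_quasispectrumRestricts]
  refine ⟨ha, QuasispectrumRestricts.nnreal_iff.mpr fun x hx => ?_⟩
  rw [Unitization.quasispectrum_eq_spectrum_inr' ℝ ℂ a] at hx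
  obtain ⟨φ, hφ⟩ := WeakDual.CharacterSpace.mem_spectrum_iff_exists.mp
    (spectrum.algebraMap_mem_iff ℂ |>.mpr hx)
  have h' : (0 : ℂ) ≤ φ (a : Unitization ℂ C) := h φ
  rw [hφ] at h'
  simpa using h'

theorem norm_le_of_ev {a : C} {r : ℝ} (hr : 0 ≤ r)
    (h : ∀ φ : WeakDual.characterSpace ℂ (Unitization ℂ C), ‖ev φ a‖ ≤ r) : ‖a‖ ≤ r := by
  rw [← Unitization.norm_inr (𝕜 := ℂ) (a := a),
    ← (gelfandTransform_isometry (Unitization ℂ C)).norm_map_of_map_zero (map_zero _)]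
  exact (ContinuousMap.norm_le _ hr).mpr h

theorem gram_posSemidef {E : Type u} [NormedAddCommGroup E] [NormedSpace ℂ E] [SMul C E]
    [CStarModule C E] (φ : WeakDual.characterSpace ℂ (Unitization ℂ C)) {n : ℕ} (x : Fin n → E) :
    (Matrix.of fun i j => ev φ (inner C (x i) (x j))).PosSemidef := by
  refine Matrix.PosSemidef.of_dotProduct_mulVec_nonneg ?_ ?_
  · ext i j
    simp [← ev_star]
  · intro v
    have : 0 ≤ ev φ (inner C (∑ i, v i • x i) (∑ i, v i • x i)) :=
      ev_nonneg φ CStarModule.inner_self_nonneg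
    convert this using 1
    simp only [dotProduct, Matrix.mulVec, Finset.mul_sum, CStarModule.inner_sum_left,
      CStarModule.inner_sum_right, CStarModule.inner_smul_left_complex,
      CStarModule.inner_smul_right_complex, map_sum, map_smul, smul_eq_mul, Matrix.of_apply,
      Pi.star_apply]
    rw [Finset.sum_comm]
    refine (Finset.sum_congr rfl fun i _ => Finset.sum_congr rfl fun j _ => ?_)
    ring

theorem exists_sum (t : AlgTensor C E F) :
    ∃ (n : ℕ) (x : Fin n → E) (y : Fin n → F), t = ∑ i, tmul C (x i) (y i) := by
  induction t using induction_on with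
  | h0 => exact ⟨0, Fin.elim0, Fin.elim0, by simp⟩
  | h1 x y => exact ⟨1, fun _ => x, fun _ => y, by simp⟩
  | h2 s t hs ht =>
    obtain ⟨n, x, y, rfl⟩ := hs
    obtain ⟨m, x', y', rfl⟩ := ht
    exact ⟨n + m, Fin.append x x', Fin.append y y', by simp [Fin.sum_univ_add]⟩

theorem ev_form_self_nonneg (φ : WeakDual.characterSpace ℂ (Unitization ℂ C))
    (t : AlgTensor C E F) : 0 ≤ ev φ (form t t) := by
  obtain ⟨n, x, y, rfl⟩ := exists_sum t
  have h := ((gram_posSemidef φ x).hadamard (gram_posSemidef φ y)).dotProduct_mulVec_nonneg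
    (fun _ => 1)
  convert h using 1
  simp [dotProduct, Matrix.mulVec, form_tmul, ev_mul]
  try exact Finset.sum_comm

theorem form_self_nonneg (t : AlgTensor C E F) : 0 ≤ form t t :=
  nonneg_of_ev (star_form t t) fun φ => ev_form_self_nonneg φ t

theorem norm_form_sq_le (s t : AlgTensor C E F) :
    ‖form s t‖ ^ 2 ≤ ‖form s s‖ * ‖form t t‖ := by
  have key : ‖form s t‖ ≤ √(‖form s s‖ * ‖form t t‖) := by
    refine norm_le_of_ev (Real.sqrt_nonneg _) fun φ => Real.le_sqrt_of_sq_le ?_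
    let core : PreInnerProductSpace.Core ℂ (AlgTensor C E F) :=
      { inner := fun s t => ev φ (form s t)
        conj_inner_symm := fun s t => by rw [← star_form t s, ev_star]; rfl
        re_inner_nonneg := fun s => (Complex.nonneg_iff.mp (ev_form_self_nonneg φ s)).1
        add_left := fun s t r => by simp
        smul_left := fun s t z => by simp }
    have h := InnerProductSpace.Core.inner_mul_inner_self_le (𝕜 := ℂ) s t
    change ‖ev φ (form s t)‖ * ‖ev φ (form t s)‖ ≤
      (ev φ (form s s)).re * (ev φ (form t t)).re at h
    rw [← star_form s t, ev_star, norm_star, ← sq] at h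
    refine h.trans ?_
    have hs := ((Complex.re_le_norm _).trans (norm_ev_le φ (form s s)))
    have ht := ((Complex.re_le_norm _).trans (norm_ev_le φ (form t t)))
    exact mul_le_mul hs ht (Complex.nonneg_iff.mp (ev_form_self_nonneg φ t)).1 (norm_nonneg _)
  exact (pow_le_pow_left₀ (norm_nonneg _) key 2).trans_eq (Real.sq_sqrt (by positivity))

theorem norm_form_le (s t : AlgTensor C E F) :
    ‖form s t‖ ≤ √‖form s s‖ * √‖form t t‖ := by
  rw [← Real.sqrt_mul (norm_nonneg _)]
  exact Real.le_sqrt_of_sq_le (norm_form_sq_le s t)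

/-! ### The seminorm -/

theorem seminorm_add_le (s t : AlgTensor C E F) :
    √‖form (s + t) (s + t)‖ ≤ √‖form s s‖ + √‖form t t‖ := by
  refine Real.sqrt_le_iff.mpr ⟨by positivity, ?_⟩
  have h1 := norm_form_le s t
  have h2 := norm_form_le t s
  have h3 := Real.sq_sqrt (norm_nonneg (form s s))
  have h4 := Real.sq_sqrt (norm_nonneg (form t t))
  have h5 : ‖form (s + t) (s + t)‖ ≤ ‖form s s‖ + ‖form s t‖ + (‖form t s‖ + ‖form t t‖) := by
    have e : form (s + t) (s + t) = form s s + form s t + (form t s + form t t) := by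
      simp only [map_add, LinearMap.add_apply]
      abel
    rw [e]
    exact (norm_add_le _ _).trans (add_le_add (norm_add_le _ _) (norm_add_le _ _))
  nlinarith

/-- The seminorm `‖t‖ = ‖⟨t, t⟩‖ ^ (1/2)` on the algebraic tensor product. -/
noncomputable instance : SeminormedAddCommGroup (AlgTensor C E F) :=
  AddGroupSeminorm.toSeminormedAddCommGroup
    { toFun := fun t => √‖form t t‖
      map_zero' := by simp
      add_le' := seminorm_add_le
      neg' := fun t => by simp }

theorem norm_def (t : AlgTensor C E F) : ‖t‖ = √‖inner C t t‖ := rfl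

noncomputable instance : NormedSpace ℂ (AlgTensor C E F) where
  norm_smul_le z t := by
    rw [norm_def, norm_def, inner_def, inner_def]
    simp only [map_smul, map_smulₛₗ, LinearMap.smul_apply, norm_smul, RCLike.norm_conj]
    rw [← mul_assoc, Real.sqrt_mul (by positivity), Real.sqrt_mul_self (norm_nonneg z)]

theorem norm_op_smul_le (c : C) (t : AlgTensor C E F) : ‖c • t‖ ≤ ‖c‖ * ‖t‖ := by
  have h : form (c • t) (c • t) = c * star c * form t t := by
    rw [form_smul_right, ← star_form, form_smul_right, star_mul, star_form, mul_comm (form t t),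
      mul_assoc]
  rw [norm_def, norm_def, inner_def, inner_def, h]
  refine Real.sqrt_le_iff.mpr ⟨by positivity, ?_⟩
  rw [mul_pow, Real.sq_sqrt (norm_nonneg _), sq, ← CStarRing.norm_self_mul_star]
  exact norm_mul_le _ _

instance : UniformContinuousConstSMul C (AlgTensor C E F) where
  uniformContinuous_const_smul c := by
    refine (LipschitzWith.of_dist_le_mul (K := ‖c‖₊) fun s t => ?_).uniformContinuous
    have h : c • s - c • t = c • (s - t) :=
      (map_sub (LinearMap.lTensor E (opSmul F c)) s t).symm
    rw [dist_eq_norm, dist_eq_norm, h]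
    exact norm_op_smul_le c (s - t)

theorem continuous_inner :
    Continuous (fun p : AlgTensor C E F × AlgTensor C E F => (inner C p.1 p.2 : C)) := by
  have h : Continuous fun p : AlgTensor C E F × AlgTensor C E F =>
      (LinearMap.mkContinuous₂ form 1 fun s t => by
        rw [one_mul]; exact norm_form_le s t :
          AlgTensor C E F →L⋆[ℂ] AlgTensor C E F →L[ℂ] C) p.1 p.2 := by
    fun_prop
  exact h

end AlgTensor

/-! ### The completed tensor product -/

/-- The completed tensor product: the (Hausdorff) completion of the algebraic tensor product
for the seminorm induced by the `C`-valued inner product. -/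
abbrev CompletedTensor (C E F : Type u)
    [NonUnitalCommCStarAlgebra C] [PartialOrder C] [StarOrderedRing C]
    [NormedAddCommGroup E] [NormedSpace ℂ E] [SMul C E] [CStarModule C E]
    [NormedAddCommGroup F] [NormedSpace ℂ F] [SMul C F] [CStarModule C F] : Type u :=
  UniformSpace.Completion (AlgTensor C E F)

namespace CompletedTensor

variable {C E F : Type u} [NonUnitalCommCStarAlgebra C] [PartialOrder C] [StarOrderedRing C]
  [NormedAddCommGroup E] [NormedSpace ℂ E] [SMul C E] [CStarModule C E]
  [NormedAddCommGroup F] [NormedSpace ℂ F] [SMul C F] [CStarModule C F]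

theorem inner_coe (s t : AlgTensor C E F) :
    inner C (s : CompletedTensor C E F) (t : CompletedTensor C E F) = inner C s t :=
  (UniformSpace.Completion.isDenseInducing_coe.prodMap
    UniformSpace.Completion.isDenseInducing_coe).extend_eq AlgTensor.continuous_inner (s, t)

theorem continuous_inner : Continuous
    (fun p : CompletedTensor C E F × CompletedTensor C E F => (inner C p.1 p.2 : C)) := by
  let inner' : AlgTensor C E F →+ AlgTensor C E F →+ C :=
    { toFun := fun x => (AlgTensor.form x).toAddMonoidHom
      map_zero' := by ext; simp
      map_add' := fun x y => by ext; simp }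
  have h : Continuous fun p : AlgTensor C E F × AlgTensor C E F => inner' p.1 p.2 :=
    AlgTensor.continuous_inner
  have key := (UniformSpace.Completion.isDenseInducing_toCompl (AlgTensor C E F)).extend_Z_bilin
    (UniformSpace.Completion.isDenseInducing_toCompl (AlgTensor C E F)) h
  exact key

theorem continuous_inner_comp {X : Type*} [TopologicalSpace X] {f g : X → CompletedTensor C E F}
    (hf : Continuous f) (hg : Continuous g) : Continuous fun p => (inner C (f p) (g p) : C) :=
  continuous_inner.comp (hf.prodMk hg)

theorem inner_complex_smul (z : ℂ) (x y : CompletedTensor C E F) :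
    inner C x (z • y) = z • (inner C x y : C) := by
  refine UniformSpace.Completion.induction_on₂ x y (isClosed_eq ?_ ?_) fun a b => ?_
  · exact continuous_inner_comp continuous_fst ((continuous_const_smul z).comp continuous_snd)
  · exact (continuous_const_smul z).comp continuous_inner
  · have h : z • (b : CompletedTensor C E F) = ((z • b : AlgTensor C E F) : CompletedTensor C E F) :=
      (UniformSpace.Completion.coe_smul z b).symm
    rw [h, inner_coe, inner_coe]
    exact map_smul (AlgTensor.form a) z b

theorem norm_eq (x : CompletedTensor C E F) : ‖x‖ = √‖inner C x x‖ := by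
  refine UniformSpace.Completion.induction_on x (isClosed_eq continuous_norm ?_) fun a => ?_
  · exact (continuous_inner_comp continuous_id continuous_id).norm.sqrt
  · rw [inner_coe, UniformSpace.Completion.norm_coe]
    rfl

/-- The inner product of the algebraic tensor product, extended by continuity. -/
noncomputable instance : CStarModule C (CompletedTensor C E F) where
  inner_add_right {x y z} := by
    refine UniformSpace.Completion.induction_on₃ x y z (isClosed_eq ?_ ?_) fun a b c => ?_
    · exact continuous_inner_comp (by fun_prop) (by fun_prop)
    · exact (continuous_inner_comp (by fun_prop) (by fun_prop)).add
        (continuous_inner_comp (by fun_prop) (by fun_prop))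
    · rw [← UniformSpace.Completion.coe_add, inner_coe, inner_coe, inner_coe]
      exact map_add (AlgTensor.form a) b c
  inner_self_nonneg {x} := by
    refine UniformSpace.Completion.induction_on x ?_ fun a => ?_
    · exact CStarAlgebra.isClosed_nonneg.preimage (continuous_inner_comp continuous_id continuous_id)
    · rw [inner_coe]
      exact AlgTensor.form_self_nonneg a
  inner_self {x} := by
    rw [← norm_eq_zero (a := x), norm_eq, Real.sqrt_eq_zero (norm_nonneg _), norm_eq_zero]
  inner_op_smul_right {c x y} := by
    refine UniformSpace.Completion.induction_on₂ x y (isClosed_eq ?_ ?_) fun a b => ?_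
    · exact continuous_inner_comp continuous_fst (continuous_snd.const_smul c)
    · exact continuous_const.mul continuous_inner
    · rw [← UniformSpace.Completion.coe_smul, inner_coe, inner_coe]
      exact AlgTensor.form_smul_right c a b
  inner_smul_right_complex {z x y} := by
    exact inner_complex_smul z x y
  star_inner x y := by
    refine UniformSpace.Completion.induction_on₂ x y (isClosed_eq ?_ ?_) fun a b => ?_
    · exact continuous_star.comp continuous_inner
    · exact continuous_inner.comp continuous_swap
    · rw [inner_coe, inner_coe]
      exact AlgTensor.star_form a b
  norm_eq_sqrt_norm_inner_self x := norm_eq x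

end CompletedTensor

/-! ### Hilbert modules and their categories -/

/-- A Hilbert module over the commutative C*-algebra `C`: a complete complex normed space with
a `C`-action and a `C`-valued inner product inducing the norm. As `C` is commutative, left and
right actions are the same thing. -/
structure HilbertModule (C : Type u) [NonUnitalCommCStarAlgebra C] [PartialOrder C]
    [StarOrderedRing C] where
  /-- The underlying space. -/
  carrier : Type u
  [normedAddCommGroup : NormedAddCommGroup carrier]
  [normedSpace : NormedSpace ℂ carrier]
  [smul : SMul C carrier]
  [cstarModule : CStarModule C carrier]
  [completeSpace : CompleteSpace carrier]

namespace HilbertModule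

variable {C : Type u} [NonUnitalCommCStarAlgebra C] [PartialOrder C] [StarOrderedRing C]

instance : CoeSort (HilbertModule C) (Type u) := ⟨carrier⟩

attribute [instance] normedAddCommGroup normedSpace smul cstarModule completeSpace

variable (C) in
/-- The algebra `C` as a Hilbert module over itself, with `⟨a, b⟩ = b * star a = star a * b`. -/
noncomputable def self : HilbertModule C where
  carrier := C

/-- The completed tensor product of two Hilbert modules. -/
noncomputable def tensor (E F : HilbertModule C) : HilbertModule C where
  carrier := CompletedTensor C E F

/-- The elementary tensor `x ⊗ y` in the completed tensor product. -/
noncomputable def tmul {E F : HilbertModule C} (x : E) (y : F) : E.tensor F :=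
  ((AlgTensor.tmul C x y : AlgTensor C E F) : CompletedTensor C E F)

theorem inner_tmul {E F : HilbertModule C} (x₁ x₂ : E) (y₁ y₂ : F) :
    (inner C (tmul x₁ y₁) (tmul x₂ y₂) : C) = inner C x₁ x₂ * inner C y₁ y₂ :=
  CompletedTensor.inner_coe _ _

theorem smul_tmul {E F : HilbertModule C} (c : C) (x : E) (y : F) :
    c • tmul x y = tmul x (c • y) :=
  (UniformSpace.Completion.coe_smul c (AlgTensor.tmul C x y)).symm

/-- A function between Hilbert modules is adjointable when it has an adjoint. -/
def Adjointable {E F : HilbertModule C} (f : E → F) : Prop :=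
  ∃ g : F → E, ∀ (x : E) (y : F), (inner C (f x) y : C) = inner C x (g y)

theorem eq_of_inner_left {E : HilbertModule C} {x y : E}
    (h : ∀ z : E, (inner C z x : C) = inner C z y) : x = y := by
  rw [← sub_eq_zero, ← CStarModule.inner_self (A := C), CStarModule.inner_sub_right, h, sub_self]

end HilbertModule

section Categories

variable (C : Type u) [NonUnitalCommCStarAlgebra C] [PartialOrder C] [StarOrderedRing C]

/-- Objects of the category of Hilbert modules and bounded `C`-linear maps. -/
@[ext]
structure HilbBd where
  /-- The underlying Hilbert module. -/
  obj : HilbertModule C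

/-- Objects of the category of Hilbert modules and adjointable maps. -/
@[ext]
structure Hilb where
  /-- The underlying Hilbert module. -/
  obj : HilbertModule C

variable {C}

/-- Morphisms are the bounded `C`-linear maps. -/
instance : Category (HilbBd C) where
  Hom E F := { f : E.obj →L[ℂ] F.obj // ∀ (c : C) (x : E.obj), f (c • x) = c • f x }
  id E := ⟨ContinuousLinearMap.id ℂ E.obj, fun _ _ => rfl⟩
  comp f g := ⟨g.1.comp f.1, fun c x => by simp [f.2, g.2]⟩

/-- Morphisms are the adjointable functions. -/
instance : Category (Hilb C) where
  Hom E F := { f : E.obj → F.obj // HilbertModule.Adjointable f }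
  id E := ⟨id, id, fun _ _ => rfl⟩
  comp f g := ⟨g.1 ∘ f.1, by
    obtain ⟨f', hf⟩ := f.2
    obtain ⟨g', hg⟩ := g.2
    exact ⟨f' ∘ g', fun x y => by simp [hf, hg]⟩⟩

/-- The function underlying a bounded `C`-linear map. -/
def HilbBd.toFun {E F : HilbBd C} (f : E ⟶ F) : E.obj → F.obj := f.1

/-- The function underlying an adjointable map. -/
def Hilb.toFun {E F : Hilb C} (f : E ⟶ F) : E.obj → F.obj := f.1

end Categories

/-! ### Dagger categories -/

/-- A dagger category: a category with an involutive, identity-on-objects, contravariant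
endofunctor. -/
class DaggerCategory (H : Type*) [Category H] where
  /-- The dagger of a morphism. -/
  dagger : ∀ {X Y : H}, (X ⟶ Y) → (Y ⟶ X)
  dagger_id : ∀ X : H, dagger (𝟙 X) = 𝟙 X
  dagger_comp : ∀ {X Y Z : H} (f : X ⟶ Y) (g : Y ⟶ Z), dagger (f ≫ g) = dagger g ≫ dagger f
  dagger_dagger : ∀ {X Y : H} (f : X ⟶ Y), dagger (dagger f) = f

namespace DaggerCategory

/-- An isomorphism is unitary when its inverse is its dagger. -/
def IsUnitary {H : Type*} [Category H] [DaggerCategory H] {X Y : H} (e : X ≅ Y) : Prop :=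
  dagger e.hom = e.inv

/-- A symmetric monoidal category with a dagger is a symmetric monoidal dagger category when the
dagger respects the tensor product of morphisms and the coherence isomorphisms are unitary. -/
structure IsSymmetricMonoidal (H : Type*) [Category H] [DaggerCategory H] [MonoidalCategory H]
    [SymmetricCategory H] : Prop where
  dagger_tensorHom : ∀ {X₁ Y₁ X₂ Y₂ : H} (f : X₁ ⟶ Y₁) (g : X₂ ⟶ Y₂),
    dagger (f ⊗ₘ g) = dagger f ⊗ₘ dagger g
  associator_unitary : ∀ X Y Z : H, IsUnitary (α_ X Y Z)
  leftUnitor_unitary : ∀ X : H, IsUnitary (λ_ X)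
  rightUnitor_unitary : ∀ X : H, IsUnitary (ρ_ X)
  braiding_unitary : ∀ X Y : H, IsUnitary (β_ X Y)

end DaggerCategory

namespace Hilb

variable {C : Type u} [NonUnitalCommCStarAlgebra C] [PartialOrder C] [StarOrderedRing C]

/-- The adjoint of an adjointable map. -/
noncomputable def adjoint {E F : Hilb C} (f : E ⟶ F) : F ⟶ E :=
  ⟨f.2.choose, f.1, fun y x => by
    rw [← CStarModule.star_inner, ← f.2.choose_spec, CStarModule.star_inner]⟩

theorem inner_toFun_left {E F : Hilb C} (f : E ⟶ F) (x : E.obj) (y : F.obj) :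
    (inner C (toFun f x) y : C) = inner C x (toFun (adjoint f) y) :=
  f.2.choose_spec x y

theorem eq_adjoint {E F : Hilb C} {f : E ⟶ F} {g : F ⟶ E}
    (h : ∀ x y, (inner C (toFun f x) y : C) = inner C x (toFun g y)) : adjoint f = g :=
  Subtype.ext <| funext fun y => HilbertModule.eq_of_inner_left fun x =>
    (inner_toFun_left f x y).symm.trans (h x y)

/-- Hilbert modules and adjointable maps form a dagger category under the adjoint. -/
noncomputable instance : DaggerCategory (Hilb C) where
  dagger f := adjoint f
  dagger_id X := eq_adjoint fun _ _ => rfl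
  dagger_comp f g := eq_adjoint fun x y =>
    (inner_toFun_left g (toFun f x) y).trans (inner_toFun_left f x _)
  dagger_dagger f := eq_adjoint fun y x => by
    rw [← CStarModule.star_inner, ← inner_toFun_left, CStarModule.star_inner]

end Hilb

/-! ### The canonical structure maps -/

namespace HilbertModule

variable {C : Type u} [NonUnitalCommCStarAlgebra C] [PartialOrder C] [StarOrderedRing C]

/-- The elementary tensor `x ⊗ y` as an element of a Hilbert module `T` that is equal to the
completed tensor product of `E` and `F`. -/
noncomputable def pureTensor {E F T : HilbertModule C} (h : T = E.tensor F) (x : E) (y : F) : T :=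
  cast (congrArg carrier h.symm) (tmul x y)

/-- An element `c` of `C` as an element of a Hilbert module `I` that is equal to `C`. -/
def scalar {I : HilbertModule C} (h : I = self C) (c : C) : I :=
  cast (congrArg carrier h.symm) c

end HilbertModule

open HilbertModule in
/-- A symmetric monoidal structure on a category `H` of Hilbert modules (each object `X` of `H`
having an underlying Hilbert module `U X`, and each morphism an underlying function) is the one
given by the completed tensor product when
* the tensor product of objects is the completed tensor product, and the unit object is `C`,
* the tensor product of morphisms, the associators, the unitors and the symmetries
  are given on elementary tensors by the usual formulas
  (as those span a dense subspace, this determines the structure). -/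
structure IsCompletedTensorStructure {C : Type u} [NonUnitalCommCStarAlgebra C] [PartialOrder C]
    [StarOrderedRing C] {H : Type*} [Category H] (U : H → HilbertModule C)
    (toFun : ∀ {X Y : H}, (X ⟶ Y) → U X → U Y)
    [MonoidalCategory H] [SymmetricCategory H] : Prop where
  obj_tensor : ∀ X Y : H, U (X ⊗ Y) = (U X).tensor (U Y)
  obj_unit : U (𝟙_ H) = HilbertModule.self C
  tensorHom_apply : ∀ {X₁ Y₁ X₂ Y₂ : H} (f : X₁ ⟶ Y₁) (g : X₂ ⟶ Y₂) (x : U X₁) (y : U X₂),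
    toFun (f ⊗ₘ g) (pureTensor (obj_tensor _ _) x y) =
      pureTensor (obj_tensor _ _) (toFun f x) (toFun g y)
  associator_apply : ∀ (X Y Z : H) (x : U X) (y : U Y) (z : U Z),
    toFun (α_ X Y Z).hom
        (pureTensor (obj_tensor _ _) (pureTensor (obj_tensor _ _) x y) z) =
      pureTensor (obj_tensor _ _) x (pureTensor (obj_tensor _ _) y z)
  leftUnitor_apply : ∀ (X : H) (c : C) (x : U X),
    toFun (λ_ X).hom (pureTensor (obj_tensor _ _) (scalar obj_unit c) x) = c • x
  rightUnitor_apply : ∀ (X : H) (c : C) (x : U X),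
    toFun (ρ_ X).hom (pureTensor (obj_tensor _ _) x (scalar obj_unit c)) = c • x
  braiding_apply : ∀ (X Y : H) (x : U X) (y : U Y),
    toFun (β_ X Y).hom (pureTensor (obj_tensor _ _) x y) = pureTensor (obj_tensor _ _) y x

/-! The analytic core is that `f ⊗ 1` is bounded for a bounded `C`-linear `f`, even when `f` has no
adjoint. Localizing with a cutoff `c ∈ C` near a character `φ` gives `φ⟨f x, f x⟩ ≤ ‖f‖² φ⟨x, x⟩`
(`ev_inner_map_self_le`). Applied to linear combinations, this says that `‖f‖²` times the Gram
matrix of the `xᵢ`, minus the Gram matrix of the `f xᵢ`, is positive semidefinite. Its Schur product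
with the Gram matrix of the `yᵢ` is again so, which bounds `f ⊗ 1` on `∑ xᵢ ⊗ yᵢ`
(`norm_rTensor_le`). Conjugating with the symmetry gives `1 ⊗ g`, hence `f ⊗ g`.

The structure maps preserve inner products on elementary tensors, so they extend to isometries
(`liftIsometry`). An isometry of complete spaces has closed range, so surjectivity needs only a
dense set of values; for the unitors this uses an approximate unit of `C`. A surjection preserving
inner products has its inverse as adjoint, which gives unitarity.

Coherence and naturality are equalities of bounded maps, so they are checked on elementary tensors
(`tensor_ext`). Adjointable maps are bounded and `C`-linear, so the same identities serve both
categories, and `f† ⊗ g†` is an adjoint of `f ⊗ g` (`inner_map_left`). -/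

namespace AlgTensor

variable {C E F : Type u} [NonUnitalCommCStarAlgebra C] [PartialOrder C] [StarOrderedRing C]
  [NormedAddCommGroup E] [NormedSpace ℂ E] [SMul C E] [CStarModule C E]
  [NormedAddCommGroup F] [NormedSpace ℂ F] [SMul C F] [CStarModule C F]

/-! ### Boundedness of `f ⊗ 1` on the algebraic tensor product -/

/-- Cutting off around a character at which some positive element does not vanish. -/
theorem exists_cutoff {a b : C} (ha : 0 ≤ a)
    (φ : WeakDual.characterSpace ℂ (Unitization ℂ C)) (hb : 0 < (ev φ b).re) {r : ℝ}
    (hr : (ev φ a).re < r) : ∃ c : C, ev φ c = 1 ∧ ‖c * (a * star c)‖ ≤ r := by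
  have hr0 : 0 < r := (Complex.nonneg_iff.mp (ev_nonneg φ ha)).1.trans_lt hr
  let A : C(WeakDual.characterSpace ℂ (Unitization ℂ C), ℂ) :=
    gelfandStarTransform _ (a : Unitization ℂ C)
  let B : C(WeakDual.characterSpace ℂ (Unitization ℂ C), ℂ) :=
    gelfandStarTransform _ (b : Unitization ℂ C)
  have hA ψ : A ψ = ev ψ a := rfl
  have hB ψ : B ψ = ev ψ b := rfl
  -- Both factors lie in `[0, 1]` and equal `1` at `φ`. The first vanishes wherever `b` does, in
  -- particular at infinity; the second makes `h · A ≤ r`.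
  let h : C(WeakDual.characterSpace ℂ (Unitization ℂ C), ℝ) :=
    { toFun := fun ψ => max 0 (min 1 ((B ψ).re / (ev φ b).re)) * (r / max (A ψ).re r)
      continuous_toFun := by
        refine .mul (by fun_prop) (.div (by fun_prop) (by fun_prop) fun ψ => ?_)
        exact (hr0.trans_le (le_max_right _ _)).ne' }
  have hh ψ : h ψ = max 0 (min 1 ((B ψ).re / (ev φ b).re)) * (r / max (A ψ).re r) := rfl
  let k : C(WeakDual.characterSpace ℂ (Unitization ℂ C), ℂ) :=
    ⟨fun ψ => (h ψ : ℂ), by fun_prop⟩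
  let v : Unitization ℂ C := (gelfandStarTransform _).symm k
  have hv ψ : ψ v = (h ψ : ℂ) := by
    have : gelfandStarTransform _ v = k := StarAlgEquiv.apply_symm_apply _ _
    exact congrArg (fun g => g ψ) this
  -- The character `ω` at infinity kills `b`, hence `h ω = 0`: the function `h` comes from an
  -- element of `C` itself, not just of its unitization.
  have hfst : v.fst = 0 := by
    let ω : WeakDual.characterSpace ℂ (Unitization ℂ C) :=
      WeakDual.CharacterSpace.equivAlgHom.symm (Unitization.fstHom ℂ C)
    have h1 : ω v = v.fst := rfl
    have h2 : B ω = 0 := by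
      have : ω (b : Unitization ℂ C) = (b : Unitization ℂ C).fst := rfl
      rw [hB]
      exact this.trans (Unitization.fst_inr ℂ b)
    rw [← h1, hv, hh, h2]
    simp
  have hsnd ψ : ev ψ v.snd = (h ψ : ℂ) := by
    rw [← hv ψ]
    change ψ (v.snd : Unitization ℂ C) = ψ v
    congr 1
    ext <;> simp [hfst]
  refine ⟨v.snd, ?_, norm_le_of_ev hr0.le fun ψ => ?_⟩
  · rw [hsnd, hh, hA, hB, div_self hb.ne', max_eq_right hr.le, div_self hr0.ne']
    simp
  · have h0 : 0 ≤ (ev ψ a).re := (Complex.nonneg_iff.mp (ev_nonneg ψ ha)).1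
    have hre : ev ψ a = ((ev ψ a).re : ℂ) := Complex.eq_re_of_ofReal_le (ev_nonneg ψ ha)
    have hm : 0 < max (ev ψ a).re r := hr0.trans_le (le_max_right _ _)
    have h1 : 0 ≤ h ψ := by
      rw [hh, hA]
      exact mul_nonneg (le_max_left _ _) (by positivity)
    have h2 : h ψ ≤ r / max (ev ψ a).re r := by
      rw [hh, hA]
      exact mul_le_of_le_one_left (by positivity) (max_le zero_le_one (min_le_left _ _))
    have h3 : h ψ ≤ 1 := h2.trans ((div_le_one hm).mpr (le_max_right _ _))
    rw [ev_mul, ev_mul, ev_star, hsnd, hre]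
    simp only [RCLike.star_def, Complex.conj_ofReal, ← Complex.ofReal_mul, Complex.norm_real]
    rw [Real.norm_of_nonneg (by positivity)]
    calc h ψ * ((ev ψ a).re * h ψ) ≤ 1 * ((ev ψ a).re * (r / max (ev ψ a).re r)) := by
          gcongr
      _ = (ev ψ a).re / max (ev ψ a).re r * r := by ring
      _ ≤ 1 * r := by
          gcongr
          exact (div_le_one hm).mpr (le_max_left _ _)
      _ = r := one_mul r

/-- A bounded `C`-linear map `f` satisfies `⟨f x, f x⟩ ≤ ‖f‖² ⟨x, x⟩`. -/
theorem ev_inner_map_self_le (f : E →L[ℂ] F) (hf : ∀ (c : C) (x : E), f (c • x) = c • f x)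
    (φ : WeakDual.characterSpace ℂ (Unitization ℂ C)) (x : E) :
    ev φ (inner C (f x) (f x)) ≤ (‖f‖ ^ 2 : ℝ) * ev φ (inner C x x) := by
  have hx := ev_nonneg φ (CStarModule.inner_self_nonneg (A := C) (x := x))
  have hfx := ev_nonneg φ (CStarModule.inner_self_nonneg (A := C) (x := f x))
  rw [Complex.eq_re_of_ofReal_le hx, Complex.eq_re_of_ofReal_le hfx, ← Complex.ofReal_mul,
    Complex.real_le_real]
  -- If `φ⟨f x, f x⟩ = 0` the bound is trivial. Otherwise `⟨f x, f x⟩` is the element `b` of the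
  -- cutoff lemma, which keeps `φ` away from infinity.
  rcases (Complex.nonneg_iff.mp hfx).1.eq_or_lt with h | h
  · rw [← h]
    exact mul_nonneg (sq_nonneg _) (Complex.nonneg_iff.mp hx).1
  -- Replacing `x` by `c • x` does not change the value at `φ`, but brings the global norm of `⟨x,
  -- x⟩` down to `r`, so that the operator norm bound becomes a bound at `φ`.
  have key : ∀ r, (ev φ (inner C x x)).re < r →
      (ev φ (inner C (f x) (f x))).re ≤ ‖f‖ ^ 2 * r := fun r hr => by
    obtain ⟨c, hc, hcr⟩ := exists_cutoff (CStarModule.inner_self_nonneg (A := C) (x := x)) φ h hr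
    calc (ev φ (inner C (f x) (f x))).re
        = (ev φ (inner C (f (c • x)) (f (c • x)))).re := by simp [hf, ev_mul, ev_star, hc]
      _ ≤ ‖(inner C (f (c • x)) (f (c • x)) : C)‖ := (Complex.re_le_norm _).trans (norm_ev_le φ _)
      _ = ‖f (c • x)‖ ^ 2 := (CStarModule.norm_sq_eq C).symm
      _ ≤ (‖f‖ * ‖c • x‖) ^ 2 := by
          gcongr
          exact f.le_opNorm _
      _ = ‖f‖ ^ 2 * ‖c * (inner C x x * star c)‖ := by
          rw [mul_pow, CStarModule.norm_sq_eq C (x := c • x)]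
          simp
      _ ≤ ‖f‖ ^ 2 * r := by gcongr
  refine le_of_forall_pos_le_add fun ε hε => ?_
  -- The `+ 1` keeps the denominator positive when `f = 0`.
  refine (key ((ev φ (inner C x x)).re + ε / (‖f‖ ^ 2 + 1)) (by
    rw [lt_add_iff_pos_right]; positivity)).trans ?_
  rw [mul_add]
  gcongr
  rw [mul_div_assoc', div_le_iff₀ (by positivity)]
  nlinarith

theorem dotProduct_gram_mulVec (φ : WeakDual.characterSpace ℂ (Unitization ℂ C)) {n : ℕ}
    (x : Fin n → E) (v : Fin n → ℂ) :
    star v ⬝ᵥ ((Matrix.of fun i j => ev φ (inner C (x i) (x j))).mulVec v) =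
      ev φ (inner C (∑ i, v i • x i) (∑ i, v i • x i)) := by
  simp only [dotProduct, Matrix.mulVec, Finset.mul_sum, CStarModule.inner_sum_left,
    CStarModule.inner_sum_right, CStarModule.inner_smul_left_complex,
    CStarModule.inner_smul_right_complex, map_sum, map_smul, smul_eq_mul, Matrix.of_apply,
    Pi.star_apply]
  rw [Finset.sum_comm]
  refine (Finset.sum_congr rfl fun i _ => Finset.sum_congr rfl fun j _ => ?_)
  ring

/-- The quadratic form at `v` is the difference of the two sides of `ev_inner_map_self_le` at `∑ vᵢ
xᵢ`. -/
theorem gram_sub_gram_map_posSemidef (f : E →L[ℂ] F)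
    (hf : ∀ (c : C) (x : E), f (c • x) = c • f x)
    (φ : WeakDual.characterSpace ℂ (Unitization ℂ C)) {n : ℕ} (x : Fin n → E) :
    (((‖f‖ ^ 2 : ℝ) : ℂ) • (Matrix.of fun i j => ev φ (inner C (x i) (x j))) -
      Matrix.of fun i j => ev φ (inner C (f (x i)) (f (x j)))).PosSemidef := by
  refine Matrix.PosSemidef.of_dotProduct_mulVec_nonneg ?_ fun v => ?_
  · ext i j
    simp [← ev_star]
  · rw [Matrix.sub_mulVec, Matrix.smul_mulVec, dotProduct_sub, dotProduct_smul,
      dotProduct_gram_mulVec, dotProduct_gram_mulVec φ (fun i => f (x i)), sub_nonneg]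
    have := ev_inner_map_self_le f hf φ (∑ i, v i • x i)
    simpa only [map_sum, map_smul, smul_eq_mul] using this

section rTensor

variable {G : Type u} [NormedAddCommGroup G] [NormedSpace ℂ G] [SMul C G] [CStarModule C G]

variable (C G) in
/-- The map `f ⊗ 1` on algebraic tensor products. -/
def rTensor (f : E →ₗ[ℂ] F) : AlgTensor C E G →ₗ[ℂ] AlgTensor C F G :=
  LinearMap.rTensor G f

theorem rTensor_tmul (f : E →ₗ[ℂ] F) (x : E) (y : G) :
    rTensor C G f (tmul C x y) = tmul C (f x) y := rfl

/-- Tensoring a bounded `C`-linear map with an identity gives a bounded map. -/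
theorem norm_rTensor_le (f : E →L[ℂ] F) (hf : ∀ (c : C) (x : E), f (c • x) = c • f x)
    (t : AlgTensor C E G) : ‖rTensor C G f.toLinearMap t‖ ≤ ‖f‖ * ‖t‖ := by
  rw [norm_def, norm_def, inner_def, inner_def]
  refine Real.sqrt_le_iff.mpr ⟨by positivity, ?_⟩
  rw [mul_pow, Real.sq_sqrt (norm_nonneg _)]
  refine norm_le_of_ev (by positivity) fun φ => ?_
  refine le_trans ?_ (mul_le_mul_of_nonneg_left (norm_ev_le φ _) (sq_nonneg _))
  have key : ev φ (form (rTensor C G f.toLinearMap t) (rTensor C G f.toLinearMap t)) ≤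
      ((‖f‖ ^ 2 : ℝ) : ℂ) * ev φ (form t t) := by
    obtain ⟨n, x, y, rfl⟩ := exists_sum t
    rw [← sub_nonneg]
    -- Schur product theorem, tested on the all-ones vector: this sums the entries of the Hadamard
    -- product, which is the difference of the two forms.
    have h := ((gram_sub_gram_map_posSemidef f hf φ x).hadamard
      (gram_posSemidef φ y)).dotProduct_mulVec_nonneg (fun _ => 1)
    convert h using 1
    simp only [dotProduct, Matrix.mulVec, Pi.star_apply, star_one, one_mul, mul_one,
      Matrix.hadamard_apply, Matrix.sub_apply, Matrix.smul_apply, Matrix.of_apply, smul_eq_mul,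
      map_sum, LinearMap.sum_apply, form_tmul, rTensor_tmul, ContinuousLinearMap.coe_coe, ev_mul,
      sub_mul, Finset.sum_sub_distrib, Finset.mul_sum, mul_assoc]
    congr 1 <;> exact Finset.sum_comm
  have h1 := CStarAlgebra.norm_le_norm_of_nonneg_of_le (ev_form_self_nonneg φ _) key
  rwa [norm_mul, Complex.norm_real, Real.norm_of_nonneg (sq_nonneg _)] at h1

end rTensor

end AlgTensor

/-! ### Hilbert modules, extension of maps to the completion, and automatic continuity -/

namespace HilbertModule

variable {C : Type u} [NonUnitalCommCStarAlgebra C] [PartialOrder C] [StarOrderedRing C]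
  {E F G H : HilbertModule C}

/-- The action is only an `SMul`; its linearity in `c` is forced by the inner product, which
separates points. -/
theorem add_op_smul (c d : C) (x : E) : (c + d) • x = c • x + d • x :=
  eq_of_inner_left fun z => by simp [add_mul]

theorem smul_op_smul (a : ℂ) (c : C) (x : E) : (a • c) • x = a • c • x :=
  eq_of_inner_left fun z => by simp [smul_mul_assoc]

theorem norm_op_smul_le (c : C) (x : E) : ‖c • x‖ ≤ ‖c‖ * ‖x‖ := by
  refine (sq_le_sq₀ (norm_nonneg _) (by positivity)).mp ?_
  rw [mul_pow, CStarModule.norm_sq_eq C (x := c • x), CStarModule.norm_sq_eq C (x := x)]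
  calc ‖(inner C (c • x) (c • x) : C)‖ = ‖c * star c * inner C x x‖ := by
        simp [mul_assoc, mul_comm (star c)]
    _ ≤ ‖c * star c‖ * ‖(inner C x x : C)‖ := norm_mul_le _ _
    _ = ‖c‖ ^ 2 * ‖(inner C x x : C)‖ := by rw [CStarRing.norm_self_mul_star, sq]

theorem continuous_op_smul (c : C) : Continuous fun x : E => c • x :=
  AddMonoidHomClass.continuous_of_bound (AlgTensor.opSmul E c) ‖c‖ (norm_op_smul_le c)

theorem continuous_inner_comp {X : Type*} [TopologicalSpace X] {f : X → E} {g : X → E}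
    (hf : Continuous f) (hg : Continuous g) : Continuous fun p => (inner C (f p) (g p) : C) :=
  CStarModule.continuous_inner.comp (hf.prodMk hg)

/-! ### Elementary tensors -/

theorem add_tmul (x x' : E) (y : F) : tmul (x + x') y = tmul x y + tmul x' y := by
  have h : AlgTensor.tmul C (x + x') y = AlgTensor.tmul C x y + AlgTensor.tmul C x' y :=
    TensorProduct.add_tmul x x' y
  exact (congrArg _ h).trans (UniformSpace.Completion.coe_add _ _)

theorem tmul_add (x : E) (y y' : F) : tmul x (y + y') = tmul x y + tmul x y' := by
  have h : AlgTensor.tmul C x (y + y') = AlgTensor.tmul C x y + AlgTensor.tmul C x y' :=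
    TensorProduct.tmul_add x y y'
  exact (congrArg _ h).trans (UniformSpace.Completion.coe_add _ _)

theorem tmul_smul_complex (a : ℂ) (x : E) (y : F) : tmul x (a • y) = a • tmul x y := by
  have h : AlgTensor.tmul C x (a • y) = a • AlgTensor.tmul C x y := TensorProduct.tmul_smul a x y
  exact (congrArg _ h).trans (UniformSpace.Completion.coe_smul _ _)

theorem smul_complex_tmul (a : ℂ) (x : E) (y : F) : tmul (a • x) y = a • tmul x y := by
  have h : AlgTensor.tmul C (a • x) y = a • AlgTensor.tmul C x y := rfl
  exact (congrArg _ h).trans (UniformSpace.Completion.coe_smul _ _)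

theorem norm_tmul_le (x : E) (y : F) : ‖tmul x y‖ ≤ ‖x‖ * ‖y‖ := by
  refine (sq_le_sq₀ (norm_nonneg _) (by positivity)).mp ?_
  rw [mul_pow, CStarModule.norm_sq_eq C (x := tmul x y), inner_tmul,
    CStarModule.norm_sq_eq C (x := x), CStarModule.norm_sq_eq C (x := y)]
  exact norm_mul_le _ _

/-- Elementary tensors as a bilinear map. -/
noncomputable def tmulₗ (E F : HilbertModule C) : E →ₗ[ℂ] F →ₗ[ℂ] E.tensor F :=
  LinearMap.mk₂ ℂ tmul add_tmul smul_complex_tmul tmul_add tmul_smul_complex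

theorem tensor_induction {p : E.tensor F → Prop} (hc : IsClosed {t | p t})
    (h0 : p 0) (htmul : ∀ x y, p (tmul x y)) (hadd : ∀ s t, p s → p t → p (s + t))
    (t : E.tensor F) : p t := by
  refine UniformSpace.Completion.induction_on (α := AlgTensor C E F) t hc fun a => ?_
  induction a using AlgTensor.induction_on with
  | h0 => exact h0
  | h1 x y => exact htmul x y
  | h2 a b ha hb =>
    rw [UniformSpace.Completion.coe_add]
    exact hadd _ _ ha hb

theorem tensor_ext {f g : E.tensor F →L[ℂ] G} (h : ∀ x y, f (tmul x y) = g (tmul x y)) :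
    f = g := by
  ext t
  refine tensor_induction (isClosed_eq f.continuous g.continuous) (by simp) h ?_ t
  intro s t hs ht
  rw [map_add, map_add, hs, ht]

/-! ### Maps out of a tensor product -/

/-- The extension to the completed tensor product of a bounded linear map. -/
noncomputable def lift (L : AlgTensor C E F →ₗ[ℂ] G) (K : ℝ) (h : ∀ t, ‖L t‖ ≤ K * ‖t‖) :
    E.tensor F →L[ℂ] G :=
  ((L.mkContinuous K h).extend UniformSpace.Completion.toComplL : CompletedTensor C E F →L[ℂ] G)

theorem lift_tmul (L : AlgTensor C E F →ₗ[ℂ] G) (K : ℝ) (h : ∀ t, ‖L t‖ ≤ K * ‖t‖)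
    (x : E) (y : F) : lift L K h (tmul x y) = L (AlgTensor.tmul C x y) := by
  have key := ContinuousLinearMap.extend_eq (e := UniformSpace.Completion.toComplL)
    (L.mkContinuous K h) UniformSpace.Completion.denseRange_coe
    (UniformSpace.Completion.isUniformInducing_coe _) (AlgTensor.tmul C x y)
  exact key

theorem map_op_smul_of_tmul {f : E.tensor F →L[ℂ] G}
    (h : ∀ (c : C) x y, f (tmul x (c • y)) = c • f (tmul x y)) (c : C) (t : E.tensor F) :
    f (c • t) = c • f t := by
  refine tensor_induction (isClosed_eq (f.continuous.comp (continuous_op_smul c))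
    ((continuous_op_smul c).comp f.continuous)) ?_ (fun x y => ?_) (fun s t hs ht => ?_) t
  · have h1 : c • (0 : E.tensor F) = 0 := map_zero (AlgTensor.opSmul _ c)
    have h2 : c • (0 : G) = 0 := map_zero (AlgTensor.opSmul _ c)
    simp [h1, h2]
  · change f (c • tmul x y) = c • f (tmul x y)
    rw [smul_tmul, h]
  · change f (c • (s + t)) = c • f (s + t)
    change f (c • s) = c • f s at hs
    change f (c • t) = c • f t at ht
    rw [AlgTensor.op_smul_add, map_add, map_add, AlgTensor.op_smul_add, hs, ht]

/-- Equalities between inner products of values of bounded linear maps out of a tensor product may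
be checked on elementary tensors. -/
theorem inner_map_map_of_tmul {f g : E.tensor F →L[ℂ] G} {a b : E.tensor F →L[ℂ] H}
    (h : ∀ x y x' y', (inner C (f (tmul x y)) (g (tmul x' y')) : C) =
      inner C (a (tmul x y)) (b (tmul x' y'))) (s t : E.tensor F) :
    (inner C (f s) (g t) : C) = inner C (a s) (b t) := by
  refine tensor_induction (isClosed_eq (continuous_inner_comp f.continuous continuous_const)
    (continuous_inner_comp a.continuous continuous_const)) (by simp) (fun x y => ?_)
    (fun s s' hs hs' => by simp [hs, hs']) s
  refine tensor_induction (isClosed_eq (continuous_inner_comp continuous_const g.continuous)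
    (continuous_inner_comp continuous_const b.continuous)) (by simp) (fun x' y' => h x y x' y')
    (fun t t' ht ht' => by simp [ht, ht']) t

theorem norm_eq_of_inner {x : E} {y : F} (h : (inner C x x : C) = inner C y y) : ‖x‖ = ‖y‖ := by
  rw [CStarModule.norm_eq_sqrt_norm_inner_self (A := C) x,
    CStarModule.norm_eq_sqrt_norm_inner_self (A := C) y, h]

/-- The linear map on the algebraic tensor product induced by a bilinear map. -/
def algLift (B : E →ₗ[ℂ] F →ₗ[ℂ] G) : AlgTensor C E F →ₗ[ℂ] G :=
  TensorProduct.lift B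

/-- Makes the bound in `liftIsometry` automatic: the induced map preserves the seminorm. -/
theorem inner_algLift (B : E →ₗ[ℂ] F →ₗ[ℂ] G)
    (h : ∀ x y x' y', (inner C (B x y) (B x' y') : C) = inner C x x' * inner C y y')
    (s t : AlgTensor C E F) :
    (inner C (algLift B s) (algLift B t) : C) = AlgTensor.form s t := by
  induction s using AlgTensor.induction_on with
  | h0 => simp
  | h1 x y =>
    induction t using AlgTensor.induction_on with
    | h0 => simp
    | h1 x' y' => exact h x y x' y'
    | h2 a b ha hb => simp [ha, hb]
  | h2 a b ha hb => simp [ha, hb]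

/-- The bounded map induced by a bilinear map that multiplies inner products. -/
noncomputable def liftIsometry (B : E →ₗ[ℂ] F →ₗ[ℂ] G)
    (h : ∀ x y x' y', (inner C (B x y) (B x' y') : C) = inner C x x' * inner C y y') :
    E.tensor F →L[ℂ] G :=
  lift (algLift B) 1 fun t => by
    rw [one_mul, AlgTensor.norm_def, AlgTensor.inner_def, ← inner_algLift B h,
      ← CStarModule.norm_eq_sqrt_norm_inner_self]

section liftIsometry

variable (B : E →ₗ[ℂ] F →ₗ[ℂ] G)
    (h : ∀ x y x' y', (inner C (B x y) (B x' y') : C) = inner C x x' * inner C y y')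

theorem liftIsometry_tmul (x : E) (y : F) : liftIsometry B h (tmul x y) = B x y :=
  lift_tmul _ _ _ x y

theorem inner_liftIsometry (s t : E.tensor F) :
    (inner C (liftIsometry B h s) (liftIsometry B h t) : C) = inner C s t := by
  refine inner_map_map_of_tmul (a := .id ℂ _) (b := .id ℂ _) (fun x y x' y' => ?_) s t
  rw [liftIsometry_tmul, liftIsometry_tmul, h]
  exact (inner_tmul x x' y y').symm

end liftIsometry

/-! ### Inner product preserving maps -/

theorem isometry_of_inner {f : E →L[ℂ] F} (h : ∀ x y, (inner C (f x) (f y) : C) = inner C x y) :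
    Isometry f :=
  AddMonoidHomClass.isometry_of_norm f fun x => norm_eq_of_inner (h x x)

/-- The range of an inner product preserving map is closed. -/
theorem isClosed_range_of_inner {f : E →L[ℂ] F}
    (h : ∀ x y, (inner C (f x) (f y) : C) = inner C x y) : IsClosed (Set.range f) :=
  (isometry_of_inner h).isClosedEmbedding.isClosed_range

/-! ### Adjointable maps -/

section Adjoint

variable {f : E → F} {g : F → E} (h : ∀ x y, (inner C (f x) y : C) = inner C x (g y))
include h

theorem inner_adjoint_swap (x : E) (y : F) : (inner C y (f x) : C) = inner C (g y) x := by
  rw [← CStarModule.star_inner, h, CStarModule.star_inner]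

theorem map_op_smul_of_adjoint (c : C) (x : E) : f (c • x) = c • f x :=
  eq_of_inner_left fun z => by simp [inner_adjoint_swap h]

end Adjoint

/-- An adjointable map is bounded and linear. -/
noncomputable def Adjointable.toCLM {f : E → F} (hf : Adjointable f) : E →L[ℂ] F :=
  ContinuousLinearMap.ofSeqClosedGraph (g :=
    { toFun := f
      map_add' := fun x y => by
        obtain ⟨g, h⟩ := hf
        exact eq_of_inner_left fun z => by simp [inner_adjoint_swap h]
      map_smul' := fun a x => by
        obtain ⟨g, h⟩ := hf
        exact eq_of_inner_left fun z => by simp [inner_adjoint_swap h] })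
    fun v x y hv hy => by
      obtain ⟨g, h⟩ := hf
      refine eq_of_inner_left fun z => ?_
      -- Closed graph: if `vₙ → x` and `f vₙ → y`, then `⟨z, f vₙ⟩ = ⟨g z, vₙ⟩` tends both to `⟨z,
      -- y⟩` and to `⟨g z, x⟩ = ⟨z, f x⟩`.
      have h1 := ((continuous_inner_comp (E := F) (continuous_const (y := z))
        continuous_id).tendsto y).comp hy
      have h2 := ((continuous_inner_comp (E := E) (continuous_const (y := g z))
        continuous_id).tendsto x).comp hv
      refine (tendsto_nhds_unique h1 (h2.congr fun n => ?_)).trans (inner_adjoint_swap h x z).symm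
      exact (inner_adjoint_swap h (v n) z).symm

theorem Adjointable.map_op_smul {f : E → F} (hf : Adjointable f) (c : C) (x : E) :
    f (c • x) = c • f x :=
  map_op_smul_of_adjoint hf.choose_spec c x

end HilbertModule

/-! ### The tensor product of maps and the structure isomorphisms -/

namespace HilbertModule

variable {C : Type u} [NonUnitalCommCStarAlgebra C] [PartialOrder C] [StarOrderedRing C]
  {E F G H K E' F' G' : HilbertModule C}

/-- The map `x ↦ x ⊗ y`. -/
noncomputable def tmulRight (E : HilbertModule C) (y : F) : E →L[ℂ] E.tensor F :=
  ((tmulₗ E F).flip y).mkContinuous ‖y‖ fun x => (norm_tmul_le x y).trans_eq (mul_comm _ _)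

theorem tmulRight_apply (x : E) (y : F) : tmulRight E y x = tmul x y := rfl

/-- The map `y ↦ x ⊗ y`. -/
noncomputable def tmulLeft (F : HilbertModule C) (x : E) : F →L[ℂ] E.tensor F :=
  (tmulₗ E F x).mkContinuous ‖x‖ fun y => norm_tmul_le x y

/-- For fixed `z`, the map `u ↦ f (u ⊗ z)` is bounded on `E ⊗ F`, so `tensor_ext` applies twice. -/
theorem tensor_ext₃ {f g : (E.tensor F).tensor G →L[ℂ] H}
    (h : ∀ x y z, f (tmul (tmul x y) z) = g (tmul (tmul x y) z)) : f = g :=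
  tensor_ext fun u z => DFunLike.congr_fun
    (tensor_ext (f := f.comp (tmulRight _ z)) (g := g.comp (tmulRight _ z)) fun x y => h x y z) u

theorem tensor_ext₄ {f g : ((E.tensor F).tensor G).tensor H →L[ℂ] K}
    (h : ∀ x y z w, f (tmul (tmul (tmul x y) z) w) = g (tmul (tmul (tmul x y) z) w)) : f = g :=
  tensor_ext fun u w => DFunLike.congr_fun
    (tensor_ext₃ (f := f.comp (tmulRight _ w)) (g := g.comp (tmulRight _ w))
      fun x y z => h x y z w) u

/-- The algebraic tensor product is taken over `ℂ` only; balancing over `C` appears in the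
completion, because both sides have the same inner product with every elementary tensor. -/
theorem op_smul_tmul (c : C) (x : E) (y : F) : tmul (c • x) y = tmul x (c • y) := by
  rw [← smul_tmul]
  have key : (tmulRight E y).comp ⟨AlgTensor.opSmul E c, continuous_op_smul c⟩ =
      (⟨AlgTensor.opSmul (E.tensor F) c, continuous_op_smul c⟩ : _ →L[ℂ] _).comp
        (tmulRight E y) := by
    ext x
    change tmul (c • x) y = c • tmul x y
    refine eq_of_inner_left fun t => ?_
    refine tensor_induction (isClosed_eq (continuous_inner_comp continuous_id continuous_const)
      (continuous_inner_comp continuous_id continuous_const)) (by simp) (fun x' y' => ?_)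
      (fun s t hs ht => by
        change (inner C (s + t) _ : C) = inner C (s + t) _
        rw [CStarModule.inner_add_left, CStarModule.inner_add_left]
        exact congrArg₂ _ hs ht) t
    change (inner C (tmul x' y') _ : C) = inner C (tmul x' y') _
    rw [CStarModule.inner_op_smul_right, inner_tmul, inner_tmul, CStarModule.inner_op_smul_right,
      mul_assoc]
  exact DFunLike.congr_fun key x

/-! ### Bounded `C`-linear maps -/

/-- Bounded `C`-linear maps. -/
abbrev Bd (E F : HilbertModule C) : Type u :=
  { f : E →L[ℂ] F // ∀ (c : C) (x : E), f (c • x) = c • f x }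

/-- The map from the algebraic to the completed tensor product. -/
noncomputable def ofAlgTensor (E F : HilbertModule C) : AlgTensor C E F →ₗ[ℂ] E.tensor F :=
  (UniformSpace.Completion.toComplL (𝕜 := ℂ) (E := AlgTensor C E F)).toLinearMap

theorem norm_ofAlgTensor (t : AlgTensor C E F) : ‖ofAlgTensor E F t‖ = ‖t‖ :=
  UniformSpace.Completion.norm_coe t

/-- The tensor product of a bounded `C`-linear map with an identity. -/
noncomputable def rTensor (G : HilbertModule C) (f : Bd E F) : Bd (E.tensor G) (F.tensor G) :=
  ⟨lift (ofAlgTensor F G ∘ₗ AlgTensor.rTensor C G f.1.toLinearMap) ‖f.1‖ fun t => by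
        rw [LinearMap.comp_apply, norm_ofAlgTensor]
        exact AlgTensor.norm_rTensor_le f.1 f.2 t,
    map_op_smul_of_tmul fun c x y => by
      rw [lift_tmul, lift_tmul]
      exact (smul_tmul c (f.1 x) y).symm⟩

theorem rTensor_tmul (f : Bd E F) (x : E) (z : G) :
    (rTensor G f).1 (tmul x z) = tmul (f.1 x) z :=
  lift_tmul _ _ _ x z

/-- The symmetry of the tensor product. -/
noncomputable def swap (E F : HilbertModule C) : E.tensor F →L[ℂ] F.tensor E :=
  liftIsometry (tmulₗ F E).flip fun x y x' y' =>
    -- The symmetry is isometric because `C` is commutative.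
    (inner_tmul y y' x x').trans (mul_comm _ _)

theorem swap_tmul (x : E) (y : F) : swap E F (tmul x y) = tmul y x :=
  liftIsometry_tmul _ _ x y

theorem inner_swap (s t : E.tensor F) :
    (inner C (swap E F s) (swap E F t) : C) = inner C s t :=
  inner_liftIsometry _ _ s t

theorem swap_comp_swap (E F : HilbertModule C) : (swap F E).comp (swap E F) = .id ℂ _ :=
  tensor_ext fun x y => by simp [swap_tmul]

theorem swap_surjective (E F : HilbertModule C) : Function.Surjective (swap E F) :=
  fun t => ⟨swap F E t, DFunLike.congr_fun (swap_comp_swap F E) t⟩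

theorem swap_op_smul (c : C) (t : E.tensor F) : swap E F (c • t) = c • swap E F t :=
  map_op_smul_of_tmul (fun c x y => by
    rw [swap_tmul, swap_tmul, op_smul_tmul, smul_tmul]) c t

/-- The tensor product of bounded `C`-linear maps. -/
noncomputable def map (f : Bd E F) (g : Bd E' F') : Bd (E.tensor E') (F.tensor F') :=
  -- `1 ⊗ g` is `g ⊗ 1` conjugated by the symmetry, so the bound for the left factor suffices.
  ⟨(rTensor F' f).1.comp ((swap F' E).comp ((rTensor E g).1.comp (swap E E'))), fun c x => by
    simp [swap_op_smul, (rTensor E g).2, (rTensor F' f).2]⟩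

theorem map_tmul (f : Bd E F) (g : Bd E' F') (x : E) (y : E') :
    (map f g).1 (tmul x y) = tmul (f.1 x) (g.1 y) := by
  simp [map, swap_tmul, rTensor_tmul]

/-- The identity as a bounded `C`-linear map. -/
def Bd.id (E : HilbertModule C) : Bd E E := ⟨.id ℂ E, fun _ _ => rfl⟩

/-- The map `x ↦ x ⊗ y` as a bounded `C`-linear map. -/
noncomputable def tmulRightBd (E : HilbertModule C) (y : F) : Bd E (E.tensor F) :=
  ⟨tmulRight E y, fun c x => (op_smul_tmul c x y).trans (smul_tmul c x y).symm⟩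

theorem tmulRightBd_apply (x : E) (y : F) : (tmulRightBd E y).1 x = tmul x y := rfl

theorem Bd.id_apply (x : E) : (Bd.id E).1 x = x := rfl

/-! ### The associator -/

/-- The bilinear map `(x ⊗ y, z) ↦ x ⊗ (y ⊗ z)`. -/
noncomputable def assocBilin (E F G : HilbertModule C) :
    E.tensor F →ₗ[ℂ] G →ₗ[ℂ] E.tensor (F.tensor G) :=
  -- For fixed `z` this is `1 ⊗ (- ⊗ z)`, already defined on the completed `E ⊗ F`. Linearity in `z`
  -- is an identity of bounded maps, checked on elementary tensors.
  LinearMap.mk₂ ℂ (fun u z => (map (.id E) (tmulRightBd F z)).1 u)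
    (fun u v z => map_add _ u v) (fun a u z => map_smul _ a u)
    (fun u z w => DFunLike.congr_fun (f := (map (.id E) (tmulRightBd F (z + w))).1)
      (g := (map (.id E) (tmulRightBd F z)).1 + (map (.id E) (tmulRightBd F w)).1)
      (tensor_ext fun x y => by
        simp [map_tmul, tmulRightBd_apply, tmul_add]) u)
    (fun a u z => DFunLike.congr_fun (f := (map (.id E) (tmulRightBd F (a • z))).1)
      (g := a • (map (.id E) (tmulRightBd F z)).1)
      (tensor_ext fun x y => by
        simp [map_tmul, tmulRightBd_apply, tmul_smul_complex]) u)

theorem assocBilin_apply (u : E.tensor F) (z : G) :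
    assocBilin E F G u z = (map (.id E) (tmulRightBd F z)).1 u := rfl

theorem inner_assocBilin (u : E.tensor F) (z : G) (v : E.tensor F) (w : G) :
    (inner C (assocBilin E F G u z) (assocBilin E F G v w) : C) = inner C u v * inner C z w := by
  -- Writing `⟨u, v⟩⟨z, w⟩` as `⟨u ⊗ z, v ⊗ w⟩` makes both sides inner products of bounded maps of
  -- `u` and `v`.
  rw [assocBilin_apply, assocBilin_apply, ← inner_tmul, ← tmulRight_apply, ← tmulRight_apply]
  refine inner_map_map_of_tmul (fun x y x' y' => ?_) u v
  simp only [map_tmul, tmulRightBd_apply, tmulRight_apply, Bd.id_apply, inner_tmul, mul_assoc]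

/-- The associator of the tensor product. -/
noncomputable def assoc (E F G : HilbertModule C) :
    (E.tensor F).tensor G →L[ℂ] E.tensor (F.tensor G) :=
  liftIsometry (assocBilin E F G) inner_assocBilin

theorem inner_assoc (s t : (E.tensor F).tensor G) :
    (inner C (assoc E F G s) (assoc E F G t) : C) = inner C s t :=
  inner_liftIsometry _ _ s t

theorem assoc_tmul (x : E) (y : F) (z : G) :
    assoc E F G (tmul (tmul x y) z) = tmul x (tmul y z) := by
  rw [assoc, liftIsometry_tmul, assocBilin_apply, map_tmul]
  rfl

/-- The range is a closed subspace containing all `x ⊗ (y ⊗ z)`. For fixed `x` it thus contains `x ⊗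
v` for every `v`, and hence everything. -/
theorem assoc_surjective (E F G : HilbertModule C) : Function.Surjective (assoc E F G) := by
  have hc : IsClosed (Set.range (assoc E F G)) := isClosed_range_of_inner inner_assoc
  refine tensor_induction hc ⟨0, map_zero _⟩ (fun x => ?_) ?_
  · refine tensor_induction (hc.preimage (tmulLeft (F.tensor G) x).continuous)
      ⟨0, (map_zero _).trans (map_zero (tmulₗ E (F.tensor G) x)).symm⟩ (fun y z => ⟨_, assoc_tmul x y z⟩) ?_
    · rintro u v ⟨a, ha⟩ ⟨b, hb⟩
      exact ⟨a + b, by rw [map_add, ha, hb]; exact (tmul_add x u v).symm⟩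
  · rintro u v ⟨a, ha⟩ ⟨b, hb⟩
    exact ⟨a + b, by rw [map_add, ha, hb]⟩

/-! ### The unitors -/

/-- The action of `C` as a bilinear map. -/
noncomputable def opSmulBilin (E : HilbertModule C) : self C →ₗ[ℂ] E →ₗ[ℂ] E :=
  LinearMap.mk₂ ℂ (M := C) (fun c x => c • x) add_op_smul smul_op_smul
    (AlgTensor.op_smul_add C E) (fun a c x => AlgTensor.op_smul_smul C E c a x)

theorem inner_opSmulBilin (a : self C) (x : E) (b : self C) (y : E) :
    (inner C (opSmulBilin E a x) (opSmulBilin E b y) : C) = inner C a b * inner C x y := by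
  have h (a b : C) : (inner C (a • x) (b • y) : C) = b * star a * inner C x y := by
    simp [mul_assoc, mul_comm (star a)]
  exact h a b

/-- The left unitor of the tensor product. -/
noncomputable def lUnitor (E : HilbertModule C) : (self C).tensor E →L[ℂ] E :=
  liftIsometry (opSmulBilin E) inner_opSmulBilin

theorem lUnitor_tmul (c : self C) (x : E) : lUnitor E (tmul c x) = opSmulBilin E c x :=
  liftIsometry_tmul _ _ _ x

theorem inner_lUnitor (s t : (self C).tensor E) :
    (inner C (lUnitor E s) (lUnitor E t) : C) = inner C s t :=
  inner_liftIsometry _ _ s t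

/-- For self-adjoint `c` with `‖c‖ ≤ 1`, and `d = ⟨x, x⟩ c - ⟨x, x⟩`, one has `‖c • x - x‖² = ‖c d -
d‖ ≤ 2 ‖d‖ → 0`. -/
theorem tendsto_op_smul_approximateUnit (x : E) :
    Filter.Tendsto (fun c : C => c • x) (CStarAlgebra.approximateUnit C) (nhds x) := by
  have hl := CStarAlgebra.increasingApproximateUnit C
  rw [tendsto_iff_norm_sub_tendsto_zero]
  have h1 := ((CStarAlgebra.tendsto_mul_left_iff_tendsto_mul_right hl.eventually_isSelfAdjoint).mpr
    hl.tendsto_mul_right (inner C x x)).sub_const (inner C x x)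
  rw [sub_self] at h1
  have h2 := (h1.norm.const_mul 2).sqrt
  rw [norm_zero, mul_zero, Real.sqrt_zero] at h2
  refine squeeze_zero' (.of_forall fun c => norm_nonneg _) ?_ h2
  filter_upwards [hl.eventually_star_eq, hl.eventually_norm] with c hc hc1
  rw [CStarModule.norm_eq_sqrt_norm_inner_self (A := C) (c • x - x)]
  refine Real.sqrt_le_sqrt ?_
  have h : (inner C (c • x - x) (c • x - x) : C) =
      c * (inner C x x * c - inner C x x) - (inner C x x * c - inner C x x) := by
    simp [hc]
  rw [h, two_mul]
  refine (norm_sub_le _ _).trans (add_le_add_left ((norm_mul_le _ _).trans ?_) _)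
  exact mul_le_of_le_one_left (norm_nonneg _) hc1

/-- As `C` may have no unit, `x` is reached only as the limit of the images `c • x` of `c ⊗ x`;
closedness of the range concludes. -/
theorem lUnitor_surjective (E : HilbertModule C) : Function.Surjective (lUnitor E) := fun x =>
  (isClosed_range_of_inner inner_lUnitor).mem_of_tendsto (tendsto_op_smul_approximateUnit x)
    (.of_forall fun c => ⟨_, lUnitor_tmul c x⟩)

/-- The right unitor of the tensor product. -/
noncomputable def rUnitor (E : HilbertModule C) : E.tensor (self C) →L[ℂ] E :=
  (lUnitor E).comp (swap E (self C))

theorem rUnitor_tmul (x : E) (c : self C) : rUnitor E (tmul x c) = opSmulBilin E c x := by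
  rw [rUnitor, ContinuousLinearMap.comp_apply, swap_tmul, lUnitor_tmul]

theorem inner_rUnitor (s t : E.tensor (self C)) :
    (inner C (rUnitor E s) (rUnitor E t) : C) = inner C s t :=
  (inner_lUnitor _ _).trans (inner_swap s t)

theorem rUnitor_surjective (E : HilbertModule C) : Function.Surjective (rUnitor E) :=
  (lUnitor_surjective E).comp (swap_surjective E _)

end HilbertModule

namespace HilbertModule

variable {C : Type u} [NonUnitalCommCStarAlgebra C] [PartialOrder C] [StarOrderedRing C]
  {E F G H K E' F' G' : HilbertModule C}

/-! ### Inner product preserving surjections -/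

/-- A surjective bounded linear map that preserves inner products. -/
structure IsUnitaryMap (f : E →L[ℂ] F) : Prop where
  inner_map : ∀ x y, (inner C (f x) (f y) : C) = inner C x y
  surjective : Function.Surjective f

namespace IsUnitaryMap

section

variable {f : E →L[ℂ] F} (hf : IsUnitaryMap f)
include hf

/-- The inverse is an adjoint. Adjointability, `C`-linearity and unitarity of all structure maps
follow from this. -/
theorem inner_left (x : E) (y : F) :
    (inner C (f x) y : C) = inner C x (Function.surjInv hf.surjective y) := by
  conv_lhs => rw [← Function.surjInv_eq hf.surjective y]
  exact hf.inner_map _ _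

theorem adjointable : Adjointable f := ⟨_, hf.inner_left⟩

theorem adjointable_surjInv : Adjointable (Function.surjInv hf.surjective) :=
  ⟨f, fun y x => (inner_adjoint_swap hf.inner_left x y).symm⟩

theorem surjInv_apply (x : E) : Function.surjInv hf.surjective (f x) = x :=
  Function.leftInverse_surjInv
    ⟨(isometry_of_inner hf.inner_map).injective, hf.surjective⟩ x

end

/-- The isomorphism given by a unitary map. -/
noncomputable def isoBd {X Y : HilbBd C} {f : X.obj →L[ℂ] Y.obj} (hf : IsUnitaryMap f) :
    X ≅ Y where
  hom := ⟨f, hf.adjointable.map_op_smul⟩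
  -- The inverse is bounded and `C`-linear because it is adjointable, with adjoint `f`.
  inv := ⟨hf.adjointable_surjInv.toCLM, hf.adjointable_surjInv.map_op_smul⟩
  hom_inv_id := Subtype.ext (ContinuousLinearMap.ext hf.surjInv_apply)
  inv_hom_id := Subtype.ext (ContinuousLinearMap.ext (Function.surjInv_eq hf.surjective))

/-- The unitary isomorphism given by a unitary map. -/
noncomputable def iso {X Y : Hilb C} {f : X.obj →L[ℂ] Y.obj} (hf : IsUnitaryMap f) :
    X ≅ Y where
  hom := ⟨f, hf.adjointable⟩
  inv := ⟨Function.surjInv hf.surjective, hf.adjointable_surjInv⟩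
  hom_inv_id := Subtype.ext (funext hf.surjInv_apply)
  inv_hom_id := Subtype.ext (funext (Function.surjInv_eq hf.surjective))

theorem isUnitary_iso {X Y : Hilb C} {f : X.obj →L[ℂ] Y.obj} (hf : IsUnitaryMap f) :
    DaggerCategory.IsUnitary (iso hf) :=
  Hilb.eq_adjoint hf.inner_left

end IsUnitaryMap

theorem isUnitaryMap_swap (E F : HilbertModule C) : IsUnitaryMap (swap E F) :=
  ⟨inner_swap, swap_surjective E F⟩

theorem isUnitaryMap_assoc (E F G : HilbertModule C) : IsUnitaryMap (assoc E F G) :=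
  ⟨inner_assoc, assoc_surjective E F G⟩

theorem isUnitaryMap_lUnitor (E : HilbertModule C) : IsUnitaryMap (lUnitor E) :=
  ⟨inner_lUnitor, lUnitor_surjective E⟩

theorem isUnitaryMap_rUnitor (E : HilbertModule C) : IsUnitaryMap (rUnitor E) :=
  ⟨inner_rUnitor, rUnitor_surjective E⟩

/-- The tensor product of adjointable maps has the tensor product of the adjoints as adjoint. -/
theorem inner_map_left {f : Bd E F} {g : Bd E' F'} {f' : Bd F E} {g' : Bd F' E'}
    (hf : ∀ x y, (inner C (f.1 x) y : C) = inner C x (f'.1 y))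
    (hg : ∀ x y, (inner C (g.1 x) y : C) = inner C x (g'.1 y)) (s : E.tensor E')
    (t : F.tensor F') : (inner C ((map f g).1 s) t : C) = inner C s ((map f' g').1 t) := by
  refine tensor_induction (isClosed_eq (continuous_inner_comp (map f g).1.continuous
    continuous_const) (continuous_inner_comp continuous_id continuous_const)) (by simp)
    (fun x y => ?_) (fun s s' hs hs' => by simp at hs hs'; simp [hs, hs']) s
  refine tensor_induction (isClosed_eq (continuous_inner_comp continuous_const
    continuous_id) (continuous_inner_comp continuous_const (map f' g').1.continuous)) (by simp)
    (fun x' y' => ?_) (fun t t' ht ht' => by simp at ht ht'; simp [ht, ht']) t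
  simp only [map_tmul, id_eq, inner_tmul, hf, hg]

/-! ### Coherence -/

/-- The bounded `C`-linear map underlying a unitary map. -/
def IsUnitaryMap.toBd {f : E →L[ℂ] F} (hf : IsUnitaryMap f) : Bd E F :=
  ⟨f, hf.adjointable.map_op_smul⟩

theorem IsUnitaryMap.toBd_apply {f : E →L[ℂ] F} (hf : IsUnitaryMap f) (x : E) :
    hf.toBd.1 x = f x := rfl

/-- The composition of bounded `C`-linear maps. -/
def Bd.comp (g : Bd F G) (f : Bd E F) : Bd E G :=
  ⟨g.1.comp f.1, fun c x => by simp [f.2, g.2]⟩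

theorem Bd.comp_apply (g : Bd F G) (f : Bd E F) (x : E) : (g.comp f).1 x = g.1 (f.1 x) := rfl

theorem map_id_id (E F : HilbertModule C) : (map (.id E) (.id F)).1 = .id ℂ (E.tensor F) :=
  tensor_ext fun x y => map_tmul _ _ x y

theorem map_comp_map (f : Bd E F) (g : Bd F G) (f' : Bd E' F') (g' : Bd F' G') :
    (map g g').1.comp (map f f').1 = (map (g.comp f) (g'.comp f')).1 :=
  tensor_ext fun x y => by simp [map_tmul, Bd.comp_apply]

theorem assoc_comp_map {E'' F'' : HilbertModule C} (f : Bd E F) (f' : Bd E' F')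
    (f'' : Bd E'' F'') : (assoc F F' F'').comp (map (map f f') f'').1 =
      (map f (map f' f'')).1.comp (assoc E E' E'') :=
  tensor_ext₃ fun x y z => by simp [map_tmul, assoc_tmul]

theorem opSmulBilin_map (f : Bd E F) (c : self C) (x : E) :
    f.1 (opSmulBilin E c x) = opSmulBilin F c (f.1 x) :=
  f.2 c x

theorem lUnitor_comp_map (f : Bd E F) :
    (lUnitor F).comp (map (.id (self C)) f).1 = f.1.comp (lUnitor E) :=
  tensor_ext fun c x => by simp [map_tmul, lUnitor_tmul, opSmulBilin_map, Bd.id_apply]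

theorem rUnitor_comp_map (f : Bd E F) :
    (rUnitor F).comp (map f (.id (self C))).1 = f.1.comp (rUnitor E) :=
  tensor_ext fun c x => by simp [map_tmul, rUnitor_tmul, opSmulBilin_map, Bd.id_apply]

theorem swap_comp_map (f : Bd E F) (g : Bd E' F') :
    (swap F F').comp (map f g).1 = (map g f).1.comp (swap E E') :=
  tensor_ext fun x y => by simp [map_tmul, swap_tmul]

theorem assoc_pentagon (E F G H : HilbertModule C) :
    ((map (.id E) (isUnitaryMap_assoc F G H).toBd).1.comp (assoc E (F.tensor G) H)).comp
        (map (isUnitaryMap_assoc E F G).toBd (.id H)).1 =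
      (assoc E F (G.tensor H)).comp (assoc (E.tensor F) G H) :=
  tensor_ext₄ fun x y z w => by
    simp [map_tmul, assoc_tmul, Bd.id_apply, IsUnitaryMap.toBd_apply]

theorem tmul_opSmulBilin (x : E) (c : self C) (y : F) :
    tmul x (opSmulBilin F c y) = tmul (opSmulBilin E c x) y :=
  (op_smul_tmul (C := C) c x y).symm

/-- On elementary tensors this is the balancing relation `x ⊗ (c • y) = (c • x) ⊗ y`. -/
theorem assoc_triangle (E F : HilbertModule C) :
    (map (.id E) (isUnitaryMap_lUnitor F).toBd).1.comp (assoc E (self C) F) =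
      (map (isUnitaryMap_rUnitor E).toBd (.id F)).1 :=
  tensor_ext₃ fun x c y => by
    simp [map_tmul, assoc_tmul, Bd.id_apply, IsUnitaryMap.toBd_apply, lUnitor_tmul, rUnitor_tmul,
      tmul_opSmulBilin]

theorem hexagon (E F G : HilbertModule C) :
    ((assoc F G E).comp (swap E (F.tensor G))).comp (assoc E F G) =
      ((map (.id F) (isUnitaryMap_swap E G).toBd).1.comp (assoc F E G)).comp
        (map (isUnitaryMap_swap E F).toBd (.id G)).1 :=
  tensor_ext₃ fun x y z => by
    simp [map_tmul, assoc_tmul, swap_tmul, Bd.id_apply, IsUnitaryMap.toBd_apply]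

end HilbertModule

open HilbertModule

/-! ### The category of bounded maps -/

namespace HilbBd

variable {C : Type u} [NonUnitalCommCStarAlgebra C] [PartialOrder C] [StarOrderedRing C]

noncomputable instance : MonoidalCategoryStruct (HilbBd C) where
  tensorObj X Y := ⟨X.obj.tensor Y.obj⟩
  tensorUnit := ⟨self C⟩
  whiskerLeft X _ _ f := map (Bd.id X.obj) f
  whiskerRight f Y := map f (Bd.id Y.obj)
  tensorHom f g := map f g
  associator X Y Z := (isUnitaryMap_assoc X.obj Y.obj Z.obj).isoBd
  leftUnitor X := (isUnitaryMap_lUnitor X.obj).isoBd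
  rightUnitor X := (isUnitaryMap_rUnitor X.obj).isoBd

noncomputable instance : MonoidalCategory (HilbBd C) :=
  .ofTensorHom
    (id_tensorHom_id := fun X Y => Subtype.ext (map_id_id X.obj Y.obj))
    (id_tensorHom := fun _ _ _ _ => rfl)
    (tensorHom_id := fun _ _ => rfl)
    (tensorHom_comp_tensorHom := fun f₁ f₂ g₁ g₂ => Subtype.ext (map_comp_map f₁ g₁ f₂ g₂))
    (associator_naturality := fun f g h => Subtype.ext (assoc_comp_map f g h))
    (leftUnitor_naturality := fun f => Subtype.ext (lUnitor_comp_map f))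
    (rightUnitor_naturality := fun f => Subtype.ext (rUnitor_comp_map f))
    (pentagon := fun W X Y Z => Subtype.ext (assoc_pentagon W.obj X.obj Y.obj Z.obj))
    (triangle := fun X Y => Subtype.ext (assoc_triangle X.obj Y.obj))

/-- The symmetry of the category of bounded maps. -/
noncomputable def braiding (X Y : HilbBd C) : X ⊗ Y ≅ Y ⊗ X :=
  (isUnitaryMap_swap X.obj Y.obj).isoBd

theorem braiding_naturality {X X' Y Y' : HilbBd C} (f : X ⟶ Y) (g : X' ⟶ Y') :
    (f ⊗ₘ g) ≫ (braiding Y Y').hom = (braiding X X').hom ≫ (g ⊗ₘ f) :=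
  Subtype.ext (swap_comp_map f g)

theorem braiding_symmetry (X Y : HilbBd C) :
    (braiding X Y).hom ≫ (braiding Y X).hom = 𝟙 (X ⊗ Y) :=
  Subtype.ext (swap_comp_swap X.obj Y.obj)

theorem braiding_hexagon (X Y Z : HilbBd C) :
    (α_ X Y Z).hom ≫ (braiding X (Y ⊗ Z)).hom ≫ (α_ Y Z X).hom =
      ((braiding X Y).hom ▷ Z) ≫ (α_ Y X Z).hom ≫ (Y ◁ (braiding X Z).hom) :=
  Subtype.ext (hexagon X.obj Y.obj Z.obj)

end HilbBd

/-- A symmetry that satisfies one hexagon identity satisfies the other one. -/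
@[reducible]
def CategoryTheory.SymmetricCategory.ofHexagonForward {D : Type*} [Category D] [MonoidalCategory D]
    (β : ∀ X Y : D, X ⊗ Y ≅ Y ⊗ X)
    (naturality : ∀ {X X' Y Y' : D} (f : X ⟶ Y) (g : X' ⟶ Y'),
      (f ⊗ₘ g) ≫ (β Y Y').hom = (β X X').hom ≫ (g ⊗ₘ f))
    (symm : ∀ X Y : D, (β X Y).hom ≫ (β Y X).hom = 𝟙 (X ⊗ Y))
    (hexagon : ∀ X Y Z : D, (α_ X Y Z).hom ≫ (β X (Y ⊗ Z)).hom ≫ (α_ Y Z X).hom =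
      ((β X Y).hom ▷ Z) ≫ (α_ Y X Z).hom ≫ (Y ◁ (β X Z).hom)) : SymmetricCategory D :=
  have hβ (X Y : D) : (β X Y).inv = (β Y X).hom := by
    rw [← cancel_epi (β X Y).hom, Iso.hom_inv_id, symm]
  { braiding := β
    braiding_naturality_left := fun f Z => by simpa using naturality f (𝟙 Z)
    braiding_naturality_right := fun Z _ _ f => by simpa using naturality (𝟙 Z) f
    hexagon_forward := hexagon
    hexagon_reverse := fun X Y Z => by
      -- The reverse hexagon for `X, Y, Z` is the inverse of the forward one for `Z, X, Y`, since
      -- inverting a symmetry swaps its arguments.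
      have h : α_ Z X Y ≪≫ β Z (X ⊗ Y) ≪≫ α_ X Y Z =
          whiskerRightIso (β Z X) Y ≪≫ α_ X Z Y ≪≫ whiskerLeftIso X (β Z Y) :=
        Iso.ext (hexagon Z X Y)
      simpa [hβ] using congrArg Iso.inv h
    symmetry := symm }

/-! ### The category of adjointable maps -/

namespace Hilb

variable {C : Type u} [NonUnitalCommCStarAlgebra C] [PartialOrder C] [StarOrderedRing C]

/-- The inclusion of the category of adjointable maps into that of bounded maps. -/
noncomputable def toHilbBd : Hilb C ⥤ HilbBd C where
  obj X := ⟨X.obj⟩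
  map f := ⟨f.2.toCLM, f.2.map_op_smul⟩
  map_id _ := rfl
  map_comp _ _ := rfl

/-- Transfers every coherence identity from bounded maps to adjointable ones. -/
theorem hom_ext {X Y : Hilb C} {f g : X ⟶ Y} (h : f.2.toCLM = g.2.toCLM) : f = g :=
  Subtype.ext (congrArg DFunLike.coe h)

/-- Serves twice: it shows that `f ⊗ g` is adjointable, and it identifies the dagger of `f ⊗ g`. -/
theorem inner_tensorHom_left {X₁ Y₁ X₂ Y₂ : Hilb C} (f : X₁ ⟶ Y₁) (g : X₂ ⟶ Y₂)
    (s : X₁.obj.tensor X₂.obj) (t : Y₁.obj.tensor Y₂.obj) :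
    (inner C ((map (toHilbBd.map f) (toHilbBd.map g)).1 s) t : C) =
      inner C s ((map (toHilbBd.map (adjoint f)) (toHilbBd.map (adjoint g))).1 t) :=
  inner_map_left (inner_toFun_left f) (inner_toFun_left g) s t

/-- The tensor product of adjointable maps. -/
noncomputable def tensorMap {X₁ Y₁ X₂ Y₂ : Hilb C} (f : X₁ ⟶ Y₁) (g : X₂ ⟶ Y₂) :
    (⟨X₁.obj.tensor X₂.obj⟩ : Hilb C) ⟶ ⟨Y₁.obj.tensor Y₂.obj⟩ :=
  ⟨(map (toHilbBd.map f) (toHilbBd.map g)).1, _, inner_tensorHom_left f g⟩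

noncomputable instance : MonoidalCategoryStruct (Hilb C) where
  tensorObj X Y := ⟨X.obj.tensor Y.obj⟩
  tensorUnit := ⟨self C⟩
  whiskerLeft X _ _ f := tensorMap (𝟙 X) f
  whiskerRight f Y := tensorMap f (𝟙 Y)
  tensorHom f g := tensorMap f g
  associator X Y Z := (isUnitaryMap_assoc X.obj Y.obj Z.obj).iso
  leftUnitor X := (isUnitaryMap_lUnitor X.obj).iso
  rightUnitor X := (isUnitaryMap_rUnitor X.obj).iso

noncomputable instance : MonoidalCategory (Hilb C) :=
  .ofTensorHom
    (id_tensorHom_id := fun X Y => hom_ext (map_id_id X.obj Y.obj))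
    (id_tensorHom := fun _ _ _ _ => rfl)
    (tensorHom_id := fun _ _ => rfl)
    (tensorHom_comp_tensorHom := fun f₁ f₂ g₁ g₂ => hom_ext
      (map_comp_map (toHilbBd.map f₁) (toHilbBd.map g₁) (toHilbBd.map f₂) (toHilbBd.map g₂)))
    (associator_naturality := fun f g h => hom_ext
      (assoc_comp_map (toHilbBd.map f) (toHilbBd.map g) (toHilbBd.map h)))
    (leftUnitor_naturality := fun f => hom_ext (lUnitor_comp_map (toHilbBd.map f)))
    (rightUnitor_naturality := fun f => hom_ext (rUnitor_comp_map (toHilbBd.map f)))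
    (pentagon := fun W X Y Z => hom_ext (assoc_pentagon W.obj X.obj Y.obj Z.obj))
    (triangle := fun X Y => hom_ext (assoc_triangle X.obj Y.obj))

/-- The symmetry of the category of adjointable maps. -/
noncomputable def braiding (X Y : Hilb C) : X ⊗ Y ≅ Y ⊗ X :=
  (isUnitaryMap_swap X.obj Y.obj).iso

noncomputable instance : SymmetricCategory (Hilb C) :=
  .ofHexagonForward braiding
    (fun f g => hom_ext (swap_comp_map (toHilbBd.map f) (toHilbBd.map g)))
    (fun X Y => hom_ext (swap_comp_swap X.obj Y.obj))
    (fun X Y Z => hom_ext (hexagon X.obj Y.obj Z.obj))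

/-- The object equations hold by `rfl`, so the casts in `pureTensor` and `scalar` vanish
definitionally and each field is a formula on elementary tensors. -/
theorem isCompletedTensorStructure :
    IsCompletedTensorStructure (Hilb.obj (C := C)) Hilb.toFun where
  obj_tensor _ _ := rfl
  obj_unit := rfl
  tensorHom_apply f g x y := map_tmul (toHilbBd.map f) (toHilbBd.map g) x y
  associator_apply _ _ _ x y z := assoc_tmul x y z
  leftUnitor_apply X c x := lUnitor_tmul (E := X.obj) c x
  rightUnitor_apply X c x := rUnitor_tmul (E := X.obj) x c
  braiding_apply _ _ x y := swap_tmul x y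

theorem isSymmetricMonoidal : DaggerCategory.IsSymmetricMonoidal (Hilb C) where
  dagger_tensorHom f g := eq_adjoint (inner_tensorHom_left f g)
  associator_unitary X Y Z := (isUnitaryMap_assoc X.obj Y.obj Z.obj).isUnitary_iso
  leftUnitor_unitary X := (isUnitaryMap_lUnitor X.obj).isUnitary_iso
  rightUnitor_unitary X := (isUnitaryMap_rUnitor X.obj).isUnitary_iso
  braiding_unitary X Y := (isUnitaryMap_swap X.obj Y.obj).isUnitary_iso

end Hilb

/-! ### Symmetry for bounded maps, and the main theorem -/

namespace HilbBd

variable {C : Type u} [NonUnitalCommCStarAlgebra C] [PartialOrder C] [StarOrderedRing C]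

noncomputable instance : SymmetricCategory (HilbBd C) :=
  .ofHexagonForward braiding braiding_naturality braiding_symmetry braiding_hexagon

theorem isCompletedTensorStructure :
    IsCompletedTensorStructure (HilbBd.obj (C := C)) HilbBd.toFun where
  obj_tensor _ _ := rfl
  obj_unit := rfl
  tensorHom_apply f g x y := map_tmul f g x y
  associator_apply _ _ _ x y z := assoc_tmul x y z
  leftUnitor_apply X c x := lUnitor_tmul (E := X.obj) c x
  rightUnitor_apply X c x := rUnitor_tmul (E := X.obj) x c
  braiding_apply _ _ x y := swap_tmul x y

end HilbBd

theorem mainTheorem11 (C : Type u) [NonUnitalCommCStarAlgebra C] [PartialOrder C]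
    [StarOrderedRing C] :
    (∃ (_ : MonoidalCategory (HilbBd C)) (_ : SymmetricCategory (HilbBd C)),
      IsCompletedTensorStructure (HilbBd.obj (C := C)) HilbBd.toFun) ∧
    (∃ (_ : MonoidalCategory (Hilb C)) (_ : SymmetricCategory (Hilb C)),
      IsCompletedTensorStructure (Hilb.obj (C := C)) Hilb.toFun ∧
      DaggerCategory.IsSymmetricMonoidal (Hilb C)) := by
  exact ⟨⟨inferInstance, inferInstance, HilbBd.isCompletedTensorStructure⟩,
    ⟨inferInstance, inferInstance, Hilb.isCompletedTensorStructure, Hilb.isSymmetricMonoidal⟩⟩
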